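/- Let $K$ be a field and let $P$ and $Q$ be finite non-empty posets. Let $r$ be the number of connected components of $P$ and $s$ the number of connected components of $Q$, where the connected components of a poset are those of the underlying undirected graph of its Hasse diagram. Let $K[P,Q]$ be the isotonian algebra of $P$ and $Q$, that is, the $K$-subalgebra of the polynomial ring $K[x_{p,q} : p\in P,\ q\in Q]$ generated by the monomials $$u_\varphi=\prod_{p\in P}x_{p,\varphi(p)},$$ one for each isotone (order-preserving) map $\varphi\colon P\to Q$. Then the Krull dimension of $K[P,Q]$ is $$\dim K[P,Q]=|P|\,(|Q|-s)+rs-r+1.$$ -/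

import Mathlib

namespace Isotonian

/-- The number of connected components of a poset: the number of connected components of the
underlying undirected graph of its Hasse diagram (vertices `P`, edges the covering pairs). -/
noncomputable def numComponents (P : Type*) [PartialOrder P] : ℕ :=
  Nat.card (SimpleGraph.hasse P).ConnectedComponent

/-- The monomial `u_φ = ∏_p x_{p, φ(p)}` attached to an isotone map `φ : P →o Q`. -/
noncomputable def isotoneMonomial (K : Type*) [Field K] {P Q : Type*} [Fintype P]
    [PartialOrder P] [PartialOrder Q] (φ : P →o Q) : MvPolynomial (P × Q) K :=
  ∏ p : P, MvPolynomial.X (p, φ p)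

/-- The isotonian algebra `K[P,Q]`: the `K`-subalgebra of the polynomial ring in the variables
`x_{p,q}` generated by the monomials `u_φ`, where `φ` runs over all isotone maps `P → Q`. -/
noncomputable def isotonianAlgebra (K P Q : Type*) [Field K] [Fintype P]
    [PartialOrder P] [PartialOrder Q] : Subalgebra K (MvPolynomial (P × Q) K) :=
  Algebra.adjoin K (Set.range fun φ : P →o Q => isotoneMonomial K φ)

end Isotonian

/-! ### Krull dimension and transcendence degree of affine domains. -/

section KrullDimension

/-! By Noether normalization the dimension of an affine domain is its transcendence degree; for a
monomial algebra this is the rank of the exponent matrix (`ringKrullDim_adjoin_monomial`).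

The rank comes from the kernel: functions `f` on `P × Q` with `∑ p, f (p, φ p) = 0` for every
isotone `φ`. Two isotone maps differing only at `p` show that `f (p, ·)` is constant on components
of `Q`. As isotone maps send components into components, and every map of components is realized,
what remains concerns only the sums `h A C` over components `A` of `P`: `∑ A, h A (c A) = 0` for all
`c`. Equivalently each `h A` is constant and these constants sum to zero, which is `r(s-1)+1`
independent conditions on a space of dimension `|P|s`. Rank-nullity finishes
(`rank_exponentMatrix_add`). -/

theorem ringKrullDim_eq_of_isIntegral_of_injective (R S : Type*) [CommRing R] [CommRing S]
    [Algebra R S] [Algebra.IsIntegral R S]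
    (hinj : Function.Injective (algebraMap R S)) : ringKrullDim S = ringKrullDim R := by
  apply le_antisymm
  · refine Order.krullDim_le_of_strictMono (PrimeSpectrum.comap (algebraMap R S)) ?_
    intro I J hIJ
    exact Ideal.IsIntegral.comap_lt_comap (I := I.asIdeal) (J := J.asIdeal) hIJ
  · refine iSup_le fun l => ?_
    -- Lying over gives a prime above the bottom of the chain; going up lifts the rest.
    obtain ⟨P, -, hPl⟩ := Ideal.exists_ideal_over_prime_of_isIntegral
      (S := S) l.head.asIdeal ⊥ (by
        rw [← RingHom.ker_eq_comap_bot, (RingHom.injective_iff_ker_eq_bot _).mp hinj]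
        exact bot_le)
    obtain ⟨hprime, hcomap⟩ := hPl
    have : P.LiesOver l.head.asIdeal := ⟨hcomap.symm⟩
    obtain ⟨L, hL, -⟩ := Ideal.exists_ltSeries_of_hasGoingUp l P
    rw [← hL]
    exact Order.LTSeries.length_le_krullDim L

/-- The Krull dimension of an affine domain is the size of any transcendence basis. -/
theorem ringKrullDim_eq_natCard_of_isTranscendenceBasis {k : Type*} {R : Type*} {ι : Type*}
    [Field k] [CommRing R] [IsDomain R] [Algebra k R] [Algebra.FiniteType k R] {x : ι → R}
    (hx : IsTranscendenceBasis k x) : ringKrullDim R = Nat.card ι := by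
  obtain ⟨n, g, hinj, hint⟩ := exists_integral_inj_algHom_of_fg k R
  algebraize [g.toRingHom]
  have : Algebra.IsIntegral (MvPolynomial (Fin n) k) R := ⟨hint⟩
  have hinj' : Function.Injective (algebraMap (MvPolynomial (Fin n) k) R) := hinj
  have : FaithfulSMul (MvPolynomial (Fin n) k) R :=
    (faithfulSMul_iff_algebraMap_injective _ _).mpr hinj'
  have : IsScalarTower k (MvPolynomial (Fin n) k) R :=
    IsScalarTower.of_algebraMap_eq fun a => (g.commutes a).symm
  have hn : ringKrullDim R = n := by
    rw [ringKrullDim_eq_of_isIntegral_of_injective _ _ hinj']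
    simp
  have htr := lift_trdeg_add_eq k (MvPolynomial (Fin n) k) R
  rw [trdeg_eq_zero (R := MvPolynomial (Fin n) k) (A := R), MvPolynomial.trdeg_of_isDomain]
    at htr
  have hcard := hx.lift_cardinalMk_eq_trdeg
  have h1 := congrArg Cardinal.toNat htr
  have h2 := congrArg Cardinal.toNat hcard
  simp only [Cardinal.toNat_lift, Cardinal.mk_fin, Cardinal.lift_natCast, Cardinal.lift_zero,
    add_zero, Cardinal.toNat_natCast] at h1 h2
  rw [hn, h1, ← h2]
  rfl

end KrullDimension

/-! ### Monomial algebras and their exponent vectors. -/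

section Monomials

variable {σ ι : Type*}

/-- Clearing denominators reduces to integer relations, and splitting coefficients into positive and
negative parts turns these into coincidences of `ℕ`-combinations. -/
theorem linearIndependent_rat_iff_linearCombination_nat_injective (a : ι → σ →₀ ℕ) :
    LinearIndependent ℚ (fun i s => (a i s : ℚ)) ↔
      Function.Injective (Finsupp.linearCombination ℕ a) := by
  rw [← linearIndependent_iff_injective_finsuppLinearCombination]
  have key : ∀ (t : Finset ι) (f : ι → ℤ) (s : σ),
      (∑ i ∈ t, f i • fun s => (a i s : ℚ)) s =
        (((∑ i ∈ t, (f i).toNat • a i) s : ℕ) : ℚ) -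
          (((∑ i ∈ t, (-f i).toNat • a i) s : ℕ) : ℚ) := by
    intro t f s
    simp only [Finset.sum_apply, Finsupp.finsetSum_apply, Finsupp.smul_apply,
      Nat.cast_sum, ← Finset.sum_sub_distrib, smul_eq_mul, Nat.cast_mul, ← sub_mul]
    refine Finset.sum_congr rfl fun i _ => ?_
    have h : ((f i).toNat : ℚ) - ((-f i).toNat : ℚ) = (f i : ℚ) := by
      exact_mod_cast congrArg (Int.cast : ℤ → ℚ) (Int.toNat_sub_toNat_neg (f i))
    rw [h]
    simp only [Pi.smul_apply, zsmul_eq_mul]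
  rw [← LinearIndependent.iff_fractionRing ℤ ℚ]
  constructor
  · intro h
    rw [linearIndependent_iff'ₛ]
    intro t f g hfg i hi
    rw [linearIndependent_iff'] at h
    have := h t (fun i => (f i : ℤ) - g i) ?_ i hi
    · simpa [sub_eq_zero] using this
    · ext s
      have hs := congrArg (fun v : σ →₀ ℕ => ((v s : ℕ) : ℚ)) hfg
      simp only [Finsupp.finsetSum_apply, Finsupp.smul_apply, Nat.cast_sum, smul_eq_mul,
        Nat.cast_mul] at hs
      simp [sub_mul, hs]
  · intro h
    rw [linearIndependent_iff']
    intro t f hf i hi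
    rw [linearIndependent_iff'ₛ] at h
    have := h t (fun i => (f i).toNat) (fun i => (-f i).toNat) ?_ i hi
    · omega
    · ext s
      have hs := key t f s
      rw [hf, Pi.zero_apply, eq_comm, sub_eq_zero] at hs
      exact_mod_cast hs

theorem MvPolynomial.aeval_monomial_eq_mapDomainAlgHom (K : Type*) [CommSemiring K]
    (a : ι → σ →₀ ℕ) :
    MvPolynomial.aeval (fun i => MvPolynomial.monomial (a i) (1 : K)) =
      AddMonoidAlgebra.mapDomainAlgHom K K (Finsupp.linearCombination ℕ a).toAddMonoidHom := by
  refine MvPolynomial.algHom_ext fun i => ?_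
  rw [MvPolynomial.aeval_X]
  simp [MvPolynomial.X, MvPolynomial.monomial]

/-- Evaluation at monomials is the map of monoid algebras induced by the exponent map, so one is
injective exactly when the other is. -/
theorem algebraicIndependent_monomial_iff (K : Type*) [Field K] (a : ι → σ →₀ ℕ) :
    AlgebraicIndependent K (fun i => MvPolynomial.monomial (a i) (1 : K)) ↔
      LinearIndependent ℚ (fun i s => (a i s : ℚ)) := by
  rw [linearIndependent_rat_iff_linearCombination_nat_injective,
    algebraicIndependent_iff_injective_aeval, MvPolynomial.aeval_monomial_eq_mapDomainAlgHom]
  constructor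
  · intro h m n hmn
    have := @h (MvPolynomial.monomial m 1) (MvPolynomial.monomial n 1) (by
      simp [MvPolynomial.monomial, hmn])
    exact MvPolynomial.monomial_left_injective one_ne_zero this
  · intro h
    exact AddMonoidAlgebra.mapDomain_injective h

theorem algebraicIndependent_iff_of_coe_eq_monomial {K : Type*} [Field K]
    {A : Subalgebra K (MvPolynomial σ K)} {u : ι → A} {a : ι → σ →₀ ℕ}
    (hu : ∀ i, (u i : MvPolynomial σ K) = MvPolynomial.monomial (a i) 1) :
    AlgebraicIndependent K u ↔ LinearIndependent ℚ (fun i s => (a i s : ℚ)) := by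
  rw [← algebraicIndependent_monomial_iff K, ← A.val.algebraicIndependent_iff Subtype.val_injective]
  have h : ⇑A.val ∘ u = fun i => MvPolynomial.monomial (a i) (1 : K) := funext hu
  rw [h]

/-- The Krull dimension of a monomial algebra is the rank of its matrix of exponents. -/
theorem ringKrullDim_adjoin_monomial (K : Type*) [Field K] [Finite ι] [Finite σ]
    (a : ι → σ →₀ ℕ) :
    ringKrullDim (Algebra.adjoin K (Set.range fun i => MvPolynomial.monomial (a i) (1 : K))) =
      Module.finrank ℚ (Submodule.span ℚ (Set.range fun i s => (a i s : ℚ))) := by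
  have := Fintype.ofFinite ι
  have := Fintype.ofFinite σ
  set A := Algebra.adjoin K (Set.range fun i => MvPolynomial.monomial (a i) (1 : K)) with hA
  let v : ι → σ → ℚ := fun i s => (a i s : ℚ)
  let u : ι → A := fun i => ⟨MvPolynomial.monomial (a i) 1, Algebra.subset_adjoin ⟨i, rfl⟩⟩
  have htop : Algebra.adjoin K (Set.range u) = ⊤ := by
    have h : Set.range u = ((↑) : A → MvPolynomial σ K) ⁻¹'
        Set.range fun i => MvPolynomial.monomial (a i) (1 : K) := by
      ext x; simp [u, Subtype.ext_iff]
    rw [h]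
    exact Algebra.adjoin_adjoin_coe_preimage
  have hft : Algebra.FiniteType K A :=
    (Subalgebra.fg_iff_finiteType A).mp <|
    Subalgebra.fg_def.mpr ⟨_, Set.finite_range _, hA.symm⟩
  have halg : Algebra.IsAlgebraic (Algebra.adjoin K (Set.range u)) A :=
    ⟨fun x => isAlgebraic_algebraMap
      (⟨x, by rw [htop]; trivial⟩ : Algebra.adjoin K (Set.range u))⟩
  -- The basis is taken among the generators, so that its size can be compared with the rank.
  obtain ⟨t, ht, hbasis⟩ := exists_isTranscendenceBasis_subset (R := K) (Set.range u)
  rw [ringKrullDim_eq_natCard_of_isTranscendenceBasis hbasis]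
  choose e he using fun x : t => ht x.2
  have hcomp : u ∘ e = ((↑) : t → A) := funext he
  have hfin : Finite t := Set.Finite.subset (Set.finite_range u) ht
  have := Fintype.ofFinite t
  have hlin : LinearIndependent ℚ (v ∘ e) := (algebraicIndependent_iff_of_coe_eq_monomial (u := u ∘ e)
    fun _ => rfl).mp (hcomp ▸ hbasis.1)
  congr 2
  apply le_antisymm
  · rw [Nat.card_eq_fintype_card, ← finrank_span_eq_card hlin]
    exact Submodule.finrank_mono (Submodule.span_mono (Set.range_comp_subset_range e v))
  · obtain ⟨κ, b, hb, hspan, hind⟩ := exists_linearIndependent' ℚ v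
    have : Finite κ := Finite.of_injective b hb
    have := Fintype.ofFinite κ
    have hle := ((algebraicIndependent_iff_of_coe_eq_monomial (u := u ∘ b) fun _ => rfl).mpr
      hind).lift_cardinalMk_le_trdeg
    have htr := hbasis.lift_cardinalMk_eq_trdeg
    change Module.finrank ℚ (Submodule.span ℚ (Set.range v)) ≤ _
    rw [← hspan, finrank_span_eq_card hind, Nat.card_eq_fintype_card]
    rw [Cardinal.lift_id, Cardinal.lift_id] at htr
    rw [← htr] at hle
    simpa using hle

end Monomials

namespace Isotonian

/-! ### Hasse components and special isotone maps. -/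

section Components

variable {P Q : Type*} [PartialOrder P] [PartialOrder Q]

theorem hasse_reachable_of_le [Finite P] {a b : P} (h : a ≤ b) :
    (SimpleGraph.hasse P).Reachable a b := by
  classical
  have := Fintype.ofFinite P
  have : LocallyFiniteOrder P := Fintype.toLocallyFiniteOrder
  rw [le_iff_reflTransGen_covBy] at h
  induction h with
  | refl => rfl
  | tail _ h ih => exact ih.trans (SimpleGraph.Adj.reachable (Or.inl h))

theorem eq_of_hasse_reachable {α : Type*} {f : P → α} (hf : ∀ a b, a ≤ b → f a = f b) {a b : P}
    (h : (SimpleGraph.hasse P).Reachable a b) : f a = f b := by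
  obtain ⟨w⟩ := h
  induction w with
  | nil => rfl
  | cons h _ ih => exact (h.elim (fun h => hf _ _ h.le) fun h => (hf _ _ h.le).symm).trans ih

/-- The component of a vertex of the Hasse diagram. -/
noncomputable abbrev comp (p : P) : (SimpleGraph.hasse P).ConnectedComponent :=
  (SimpleGraph.hasse P).connectedComponentMk p

theorem comp_eq_of_le [Finite P] {a b : P} (h : a ≤ b) : comp a = comp b :=
  SimpleGraph.ConnectedComponent.eq.mpr (hasse_reachable_of_le h)

theorem eq_of_comp_eq {α : Type*} {f : P → α} (hf : ∀ a b, a ≤ b → f a = f b) {a b : P}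
    (h : comp a = comp b) : f a = f b :=
  eq_of_hasse_reachable hf (SimpleGraph.ConnectedComponent.eq.mp h)

/-- An isotone map that is constant on each component. -/
noncomputable def componentwiseConst [Finite P]
    (c : (SimpleGraph.hasse P).ConnectedComponent → Q) : P →o Q where
  toFun p := c (comp p)
  monotone' _ _ h := (congrArg c (comp_eq_of_le h)).le

open Classical in
/-- The isotone map with value `q'` on the elements `x` with `¬ x ≤ p`, and `q` elsewhere. -/
noncomputable def stepAbove (p : P) {q q' : Q} (h : q ≤ q') : P →o Q where
  toFun x := if x ≤ p then q else q'
  monotone' x y hxy := by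
    dsimp only
    split_ifs with h1 h2 h2
    · exact le_rfl
    · exact h
    · exact absurd (hxy.trans h2) h1
    · exact le_rfl

open Classical in
/-- The isotone map with value `q'` on the elements `x` with `¬ x < p`, and `q` elsewhere. -/
noncomputable def stepFrom (p : P) {q q' : Q} (h : q ≤ q') : P →o Q where
  toFun x := if x < p then q else q'
  monotone' x y hxy := by
    dsimp only
    split_ifs with h1 h2 h2
    · exact le_rfl
    · exact h
    · exact absurd (hxy.trans_lt h2) h1
    · exact le_rfl

open Classical in
theorem stepAbove_apply (p : P) {q q' : Q} (h : q ≤ q') (x : P) :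
    stepAbove p h x = if x ≤ p then q else q' := rfl

open Classical in
theorem stepFrom_apply (p : P) {q q' : Q} (h : q ≤ q') (x : P) :
    stepFrom p h x = if x < p then q else q' := rfl

end Components

/-! ### Kernel and rank of the exponent matrix. -/

section Rank

variable (P Q : Type*) [PartialOrder P] [PartialOrder Q] [Fintype P]

open Classical in
/-- The matrix of exponents of the monomials `u_φ`. -/
noncomputable def exponentMatrix : Matrix (P →o Q) (P × Q) ℚ :=
  fun φ x => if φ x.1 = x.2 then 1 else 0

theorem exponentMatrix_mulVec [Fintype Q] (f : P × Q → ℚ) (φ : P →o Q) :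
    (exponentMatrix P Q).mulVec f φ = ∑ p, f (p, φ p) := by
  classical
  simp [exponentMatrix, Matrix.mulVec, dotProduct, Fintype.sum_prod_type]

variable {P Q}

/-- For `a ≤ b` in `Q`, `stepAbove p` and `stepFrom p` differ only at `p`, with values `a` and `b`
there; subtracting their relations isolates `f (p, a) = f (p, b)`. -/
theorem eq_of_comp_eq_of_mulVec_eq_zero [Fintype Q] {f : P × Q → ℚ}
    (hf : (exponentMatrix P Q).mulVec f = 0) (p : P) {q q' : Q} (h : comp q = comp q') :
    f (p, q) = f (p, q') := by
  classical
  refine eq_of_comp_eq (f := fun q => f (p, q)) (fun a b hab => ?_) h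
  have h1 := congrFun hf (stepAbove p hab)
  have h2 := congrFun hf (stepFrom p hab)
  rw [exponentMatrix_mulVec, ← Finset.add_sum_erase _ _ (Finset.mem_univ p)] at h1 h2
  have hsum : ∑ x ∈ Finset.univ.erase p, f (x, stepAbove p hab x) =
      ∑ x ∈ Finset.univ.erase p, f (x, stepFrom p hab x) := by
    refine Finset.sum_congr rfl fun x hx => ?_
    have hne := (Finset.mem_erase.mp hx).1
    have : stepAbove p hab x = stepFrom p hab x := by
      simp [stepAbove_apply, stepFrom_apply, lt_iff_le_and_ne, hne]
    rw [this]
  have ha : stepAbove p hab p = a := by simp [stepAbove_apply]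
  have hb : stepFrom p hab p = b := by simp [stepFrom_apply]
  rw [ha] at h1
  rw [hb] at h2
  linarith [h1.trans h2.symm]

/-- The sum of `g (·, C)` over a component `A` of `P`. -/
noncomputable def componentSum {ι : Type*} :
    (P × ι → ℚ) →ₗ[ℚ] ((SimpleGraph.hasse P).ConnectedComponent → ι → ℚ) :=
  open Classical in
  { toFun := fun g A C => ∑ p with comp p = A, g (p, C)
    map_add' := fun g g' => by ext; simp [Finset.sum_add_distrib]
    map_smul' := fun c g => by ext; simp [Finset.mul_sum] }

theorem componentSum_surjective {ι : Type*} :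
    Function.Surjective (componentSum (P := P) (ι := ι)) := by
  classical
  intro h
  choose ρ hρ using fun A : (SimpleGraph.hasse P).ConnectedComponent => A.exists_rep
  -- All the mass of a component sits at its chosen representative.
  refine ⟨fun x => if ρ (comp x.1) = x.1 then h (comp x.1) x.2 else 0, ?_⟩
  ext A C
  simp only [componentSum, LinearMap.coe_mk, AddHom.coe_mk]
  rw [Finset.sum_eq_single (ρ A)]
  · have : comp (ρ A) = A := hρ A
    simp [this]
  · intro p hp hne
    have hp' := (Finset.mem_filter.mp hp).2
    rw [hp', if_neg (Ne.symm hne)]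
  · intro hn
    exact absurd (Finset.mem_filter.mpr ⟨Finset.mem_univ (ρ A), (hρ A : comp (ρ A) = A)⟩) hn

theorem sum_eq_sum_componentSum {ι : Type*} [Fintype (SimpleGraph.hasse P).ConnectedComponent]
    (g : P × ι → ℚ) (c : (SimpleGraph.hasse P).ConnectedComponent → ι) :
    ∑ p, g (p, c (comp p)) = ∑ A, componentSum g A (c A) := by
  classical
  rw [← Finset.sum_fiberwise Finset.univ (fun p : P => comp p)]
  refine Finset.sum_congr rfl fun A _ => ?_
  simp only [componentSum, LinearMap.coe_mk, AddHom.coe_mk]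
  refine Finset.sum_congr (by congr) fun p hp => ?_
  rw [(Finset.mem_filter.mp hp).2]

/-- The linear conditions on `h` saying that `∑ A, h A (c A) = 0` for all `c`. -/
noncomputable def transversalConditions {α ι : Type*} [Fintype α] (C₀ : ι) :
    (α → ι → ℚ) →ₗ[ℚ] (α → {C // C ≠ C₀} → ℚ) × ℚ where
  toFun h := (fun A C => h A C - h A C₀, ∑ A, h A C₀)
  map_add' h h' := by
    ext
    · simp; ring
    · simp [Finset.sum_add_distrib]
  map_smul' c h := by
    ext
    · simp [mul_sub]
    · simp [Finset.mul_sum]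

theorem transversalConditions_surjective {α ι : Type*} [Fintype α] [Nonempty α] (C₀ : ι) :
    Function.Surjective (transversalConditions (α := α) C₀) := by
  classical
  rintro ⟨y, z⟩
  obtain ⟨A₀⟩ := ‹Nonempty α›
  refine ⟨fun A C => (if h : C ≠ C₀ then y A ⟨C, h⟩ else 0) + if A = A₀ then z else 0, ?_⟩
  ext
  · rename_i A C
    simp [transversalConditions, C.2]
  · simp [transversalConditions]

theorem transversalConditions_eq_zero_iff {α ι : Type*} [Fintype α] (C₀ : ι) (h : α → ι → ℚ) :
    transversalConditions C₀ h = 0 ↔ ∀ c : α → ι, ∑ A, h A (c A) = 0 := by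
  classical
  simp only [transversalConditions, LinearMap.coe_mk, AddHom.coe_mk, Prod.mk_eq_zero]
  constructor
  · rintro ⟨h1, h2⟩ c
    rw [← h2]
    refine Finset.sum_congr rfl fun A _ => ?_
    by_cases hc : c A = C₀
    · rw [hc]
    · exact sub_eq_zero.mp (congrFun (congrFun h1 A) ⟨c A, hc⟩)
  · intro hc
    refine ⟨?_, hc fun _ => C₀⟩
    ext A C
    -- Changing the constant choice `C₀` at `A` alone isolates `h A C - h A C₀`.
    have h1 := hc (Function.update (fun _ => C₀) A C)
    have h2 := hc fun _ => C₀
    rw [← Finset.add_sum_erase _ _ (Finset.mem_univ A)] at h1 h2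
    rw [Function.update_self, Finset.sum_congr rfl (g := fun B => h B C₀)] at h1
    · simp only [Pi.zero_apply]
      linarith
    · intro B hB
      rw [Function.update_of_ne (Finset.mem_erase.mp hB).1]

/-- The relations among the columns of the exponent matrix depend only on the component of `q`, and
are cut out there by the transversal conditions on the component sums. -/
theorem ker_exponentMatrix_mulVecLin [Fintype Q]
    [Fintype (SimpleGraph.hasse P).ConnectedComponent]
    (C₀ : (SimpleGraph.hasse Q).ConnectedComponent) :
    LinearMap.ker (exponentMatrix P Q).mulVecLin =
      (LinearMap.ker (transversalConditions C₀ ∘ₗ componentSum)).map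
        (LinearMap.funLeft ℚ ℚ (Prod.map (id : P → P) (comp : Q → _))) := by
  choose ρ hρ using fun C : (SimpleGraph.hasse Q).ConnectedComponent => C.exists_rep
  have hρ' : ∀ C, comp (ρ C) = C := hρ
  ext f
  simp only [Submodule.mem_map, LinearMap.mem_ker, Matrix.mulVecLin_apply, LinearMap.comp_apply,
    transversalConditions_eq_zero_iff]
  constructor
  · intro hf
    refine ⟨fun x => f (x.1, ρ x.2), fun c => ?_, ?_⟩
    · rw [← sum_eq_sum_componentSum]
      have := congrFun hf (componentwiseConst fun A => ρ (c A))
      rwa [exponentMatrix_mulVec] at this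
    · ext ⟨p, q⟩
      exact eq_of_comp_eq_of_mulVec_eq_zero hf p (hρ' _)
  · rintro ⟨g, hg, rfl⟩
    ext φ
    rw [exponentMatrix_mulVec]
    choose τ hτ using fun A : (SimpleGraph.hasse P).ConnectedComponent => A.exists_rep
    have hφ : ∀ p, comp (φ p) = comp (φ (τ (comp p))) := fun p =>
      eq_of_comp_eq (f := fun p => comp (φ p)) (fun _ _ h => comp_eq_of_le (φ.monotone h))
        (hτ (comp p)).symm
    have := hg fun A => comp (φ (τ A))
    rw [← sum_eq_sum_componentSum] at this
    rw [Pi.zero_apply, ← this]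
    refine Finset.sum_congr rfl fun p _ => ?_
    rw [LinearMap.funLeft_apply, Prod.map_apply, id_eq, hφ]

/-- Rank-nullity is used twice: for the matrix, and for the surjective conditions cutting out its
kernel. The additive form avoids truncated subtraction in `ℕ`. -/
theorem rank_exponentMatrix_add [Fintype Q] [Nonempty P] [Nonempty Q] :
    (exponentMatrix P Q).rank + Fintype.card P * numComponents Q + numComponents P =
      Fintype.card P * Fintype.card Q + numComponents P * numComponents Q + 1 := by
  classical
  have : Fintype (SimpleGraph.hasse P).ConnectedComponent := Fintype.ofFinite _
  have : Fintype (SimpleGraph.hasse Q).ConnectedComponent := Fintype.ofFinite _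
  have : Nonempty (SimpleGraph.hasse P).ConnectedComponent := ‹Nonempty P›.map comp
  obtain ⟨q₀⟩ := ‹Nonempty Q›
  have hsurj : Function.Surjective (transversalConditions (comp q₀) ∘ₗ componentSum (P := P)) :=
    (transversalConditions_surjective _).comp componentSum_surjective
  have hinj : Function.Injective
      (LinearMap.funLeft ℚ ℚ (Prod.map (id : P → P) (comp : Q → _))) :=
    LinearMap.funLeft_injective_of_surjective _ _ _
      (Function.surjective_id.prodMap fun C => C.exists_rep)
  have h1 := LinearMap.finrank_range_add_finrank_ker (exponentMatrix P Q).mulVecLin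
  rw [ker_exponentMatrix_mulVecLin (comp q₀),
    ← (Submodule.equivMapOfInjective _ hinj _).finrank_eq] at h1
  have h2 := LinearMap.finrank_range_add_finrank_ker
    (transversalConditions (comp q₀) ∘ₗ componentSum (P := P))
  rw [LinearMap.range_eq_top.mpr hsurj, finrank_top] at h2
  simp only [Module.finrank_prod, Module.finrank_pi, Module.finrank_pi_fintype, Finset.sum_const,
    Finset.card_univ, smul_eq_mul, Fintype.card_prod, Module.finrank_self] at h1 h2
  have h3 : Fintype.card {C // C ≠ comp q₀} + 1 = numComponents Q := by
    rw [numComponents, Nat.card_eq_fintype_card, Fintype.card_subtype_compl,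
      Fintype.card_subtype_eq, Nat.sub_add_cancel Fintype.card_pos]
  have h4 : Fintype.card (SimpleGraph.hasse P).ConnectedComponent = numComponents P :=
    Nat.card_eq_fintype_card.symm
  have h5 : Fintype.card (SimpleGraph.hasse Q).ConnectedComponent = numComponents Q :=
    Nat.card_eq_fintype_card.symm
  rw [h4, h5, ← h3] at h2
  rw [← h3]
  change (exponentMatrix P Q).rank + _ = _ at h1
  nlinarith

end Rank

theorem isotoneMonomial_eq_monomial (K : Type*) [Field K] {P Q : Type*} [Fintype P]
    [PartialOrder P] [PartialOrder Q] (φ : P →o Q) :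
    isotoneMonomial K φ = MvPolynomial.monomial (∑ p, Finsupp.single (p, φ p) 1) 1 := by
  simp [isotoneMonomial, MvPolynomial.monomial_sum_one, MvPolynomial.X]

end Isotonian

theorem theorem2p1 (K P Q : Type*) [Field K]
    [PartialOrder P] [Fintype P] [Nonempty P]
    [PartialOrder Q] [Fintype Q] [Nonempty Q]
    (r s : ℕ) (hr : Isotonian.numComponents P = r) (hs : Isotonian.numComponents Q = s) :
    ∃ d : ℕ, ringKrullDim (Isotonian.isotonianAlgebra K P Q) = (d : WithBot ℕ∞) ∧
      (d : ℤ) = (Fintype.card P : ℤ) * ((Fintype.card Q : ℤ) - (s : ℤ))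
        + (r : ℤ) * (s : ℤ) - (r : ℤ) + 1 := by
  classical
  refine ⟨(Isotonian.exponentMatrix P Q).rank, ?_, ?_⟩
  · have : Finite (P →o Q) := DFunLike.finite _
    have h : Isotonian.isotonianAlgebra K P Q =
        Algebra.adjoin K (Set.range fun φ : P →o Q =>
          MvPolynomial.monomial (∑ p, Finsupp.single (p, φ p) 1) 1) :=
      congrArg (fun u : (P →o Q) → MvPolynomial (P × Q) K => Algebra.adjoin K (Set.range u))
        (funext (Isotonian.isotoneMonomial_eq_monomial K))
    rw [h, ringKrullDim_adjoin_monomial, Matrix.rank_eq_finrank_span_row]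
    have : (fun (φ : P →o Q) (x : P × Q) =>
        (((∑ p, Finsupp.single (p, φ p) 1 : P × Q →₀ ℕ) x : ℕ) : ℚ)) =
          (Isotonian.exponentMatrix P Q).row := by
      ext φ ⟨p, q⟩
      simp [Isotonian.exponentMatrix, Matrix.row, Finsupp.single_apply,
        Finsupp.finsetSum_apply, ite_and]
    rw [this]
  · have h := Isotonian.rank_exponentMatrix_add (P := P) (Q := Q)
    rw [hr, hs] at h
    zify at h
    linarith
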